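/- **Setting.** Let $G=(L,R,E,w)$ be a finite bipartite graph, $E\subseteq L\times R$, with weights $w_{ab}\ge 0$ for $a\in L$, $b\in R$. Let $g,h:[0,1]\to\mathbb R_{\ge0}$ be right-continuous, $g$ non-increasing with $g>0$ on $[0,1)$ and $g(1)=0$, $h$ non-decreasing with $h>0$ on $[0,1]$, and $h(x)g(y)+h(y)g(x)\le 1$ for all $x,y\in[0,1]$. Every vertex $x\in L\cup R$ draws an independent uniform rank $y_x\in[0,1)$. The algorithm (Quadratic Ranking) goes through the pairs $(a,b)\in L\times R$ in descending order of the perturbed weight $g(y_a)g(y_b)w_{ab}$, ties (if any) being broken by an arbitrary fixed linear order on $L\times R$, and adds $(a,b)$ to the matching whenever $(a,b)\in E$ and both $a$ and $b$ are still unmatched. The dual variables $\alpha_x$ are any measurable functions of the ranks such that, whenever $(a,b)$ is matched, $\alpha_a\ge h(y_a)g(y_b)w_{ab}$, $\alpha_b\ge h(y_b)g(y_a)w_{ab}$ and $\alpha_a+\alpha_b=w_{ab}$, and such that $\alpha_x=0$ for every unmatched vertex $x$. For a non-increasing $f$ on $[0,1]$ let $f^{-1}(y)=\inf\{x\in[0,1]:f(x)\le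 y\}$, and for a non-decreasing $f$ let $f^{-1}(y)=\inf\{x\in[0,1]:f(x)>y\}$, where $\inf\varnothing=1$. Fix an edge $(u,v)\in E$ with $w_{uv}>0$, and fix the ranks in $[0,1)$ of all vertices other than $u$ and $v$ arbitrarily. For $y_v\in[0,1)$, run the algorithm with $u$ removed from the graph and with $v$ having rank $y_v$. If it matches $v$ to $p$, let $\theta(y_v)=g^{-1}\big(g(y_p)w_{pv}/w_{uv}\big)$; if it leaves $v$ unmatched, let $\theta(y_v)=g^{-1}(0)$. Put $\theta(1)=1$. This is the marginal rank of $u$. Define the marginal rank $\beta(y_u)$ of $v$ symmetrically: remove $v$, give $u$ the rank $y_u$, let $\beta(y_u)=g^{-1}\big(g(y_q)w_{uq}/w_{uv}\big)$ if $u$ is matched to $q$ and $\beta(y_u)=g^{-1}(0)$ if $u$ is unmatched, and put $\beta(1)=1$. **Lemma (Universal Lower Bound).** The functions $\theta$ and $\beta$ are non-decreasing on $[0,1]$, all the integrands below are integrable, and, with the expectation taken over independent uniform $y_u,y_v\in[0,1)$ for the fixed ranks of the other vertices, $$\frac{\mathbb E[\alpha_u+\alpha_v]}{w_{uv}}\ \ge\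 \int_0^1\big(\theta(y)-\beta^{-1}(y)\big)^+\,dy+\int_0^1\Big(1-\big(\theta(y)-\beta^{-1}(y)\big)^+\Big)h(y)\,g(\theta(y))\,dy+\int_0^1\Big(1-\big(\beta(y)-\theta^{-1}(y)\big)^+\Big)h(y)\,g(\beta(y))\,dy,$$ where $x^+=\max\{x,0\}$. -/

import Mathlib

namespace QuadraticRanking

open MeasureTheory

/-- The parameters `g, h : [0,1] → ℝ≥0` of the algorithm (only their values on `[0,1]` matter). -/
structure IsParam (g h : ℝ → ℝ) : Prop where
  g_anti : AntitoneOn g (Set.Icc 0 1)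
  g_rightCont : ∀ y ∈ Set.Icc (0 : ℝ) 1, ContinuousWithinAt g (Set.Icc y 1) y
  g_pos : ∀ y ∈ Set.Ico (0 : ℝ) 1, 0 < g y
  g_one : g 1 = 0
  h_mono : MonotoneOn h (Set.Icc 0 1)
  h_rightCont : ∀ y ∈ Set.Icc (0 : ℝ) 1, ContinuousWithinAt h (Set.Icc y 1) y
  h_pos : ∀ y ∈ Set.Icc (0 : ℝ) 1, 0 < h y
  share_le_one : ∀ x ∈ Set.Icc (0 : ℝ) 1, ∀ y ∈ Set.Icc (0 : ℝ) 1, h x * g y + h y * g x ≤ 1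

/-- Inverse of a non-increasing function on `[0,1]`: `inf {x ∈ [0,1] | f x ≤ y}`.
Inserting the point `1` implements the convention `inf ∅ = 1` and changes nothing otherwise. -/
noncomputable def decInv (f : ℝ → ℝ) (y : ℝ) : ℝ :=
  sInf (insert 1 {x : ℝ | x ∈ Set.Icc (0 : ℝ) 1 ∧ f x ≤ y})

/-- Inverse of a non-decreasing function on `[0,1]`: `inf {x ∈ [0,1] | f x > y}`,
with the convention `inf ∅ = 1`. -/
noncomputable def incInv (f : ℝ → ℝ) (y : ℝ) : ℝ :=
  sInf (insert 1 {x : ℝ | x ∈ Set.Icc (0 : ℝ) 1 ∧ f x > y})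

section Algorithm

variable {L R : Type*}

/-- Perturbed weight of the pair `e = (u, v)` under the ranks `y`. -/
def perturbedWeight (g : ℝ → ℝ) (w : L → R → ℝ) (y : L ⊕ R → ℝ) (e : L × R) : ℝ :=
  g (y (Sum.inl e.1)) * g (y (Sum.inr e.2)) * w e.1 e.2

/-- `e` is queried no later than `f`: larger perturbed weights come first, and ties are broken
by a fixed injective priority index `τ` that does not depend on the ranks. -/
def QueriedBefore (g : ℝ → ℝ) (w : L → R → ℝ) (τ : L × R → ℕ) (y : L ⊕ R → ℝ)
    (e f : L × R) : Prop :=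
  perturbedWeight g w y f < perturbedWeight g w y e ∨
    (perturbedWeight g w y e = perturbedWeight g w y f ∧ τ e ≤ τ f)

noncomputable instance (g : ℝ → ℝ) (w : L → R → ℝ) (τ : L × R → ℕ) (y : L ⊕ R → ℝ) :
    DecidableRel (QueriedBefore g w τ y) :=
  Classical.decRel _

variable [Fintype L] [Fintype R] [DecidableEq L] [DecidableEq R]

/-- All pairs of `L × R`, listed in the order in which they are queried. -/
noncomputable def queryOrder (g : ℝ → ℝ) (w : L → R → ℝ) (τ : L × R → ℕ) (y : L ⊕ R → ℝ) :
    List (L × R) :=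
  (Finset.univ : Finset (L × R)).toList.insertionSort (QueriedBefore g w τ y)

/-- One step: if the pair `e` is an edge and both its endpoints are still unmatched,
it is added to the current matching. -/
def queryStep (E : Finset (L × R)) (M : Finset (L × R)) (e : L × R) : Finset (L × R) :=
  if e ∈ E ∧ ∀ f ∈ M, f.1 ≠ e.1 ∧ f.2 ≠ e.2 then insert e M else M

/-- The matching produced by the algorithm on the edge set `E` under the ranks `y`. -/
noncomputable def matching (g : ℝ → ℝ) (E : Finset (L × R)) (w : L → R → ℝ) (τ : L × R → ℕ)
    (y : L ⊕ R → ℝ) : Finset (L × R) :=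
  (queryOrder g w τ y).foldl (queryStep E) ∅

/-- The edges that remain when the left vertex `u` is removed. -/
def removeLeft (E : Finset (L × R)) (u : L) : Finset (L × R) :=
  E.filter (fun e => e.1 ≠ u)

/-- The edges that remain when the right vertex `v` is removed. -/
def removeRight (E : Finset (L × R)) (v : R) : Finset (L × R) :=
  E.filter (fun e => e.2 ≠ v)

/-- The ranks `y` with the ranks of `u` and `v` replaced by `yu` and `yv`. -/
def setRanks (y : L ⊕ R → ℝ) (u : L) (v : R) (yu yv : ℝ) : L ⊕ R → ℝ :=
  Function.update (Function.update y (Sum.inl u) yu) (Sum.inr v) yv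

/-- The value `g (y_p) * w_{pv}` of the edge `(p, v)` by which the right vertex `v` is matched
in the matching `M`, and `0` if `v` is unmatched (the sum has at most one term). -/
def rightOffer (g : ℝ → ℝ) (w : L → R → ℝ) (y : L ⊕ R → ℝ) (M : Finset (L × R)) (v : R) : ℝ :=
  ∑ e ∈ M with e.2 = v, g (y (Sum.inl e.1)) * w e.1 v

/-- The value `g (y_q) * w_{uq}` of the edge `(u, q)` by which the left vertex `u` is matched
in the matching `M`, and `0` if `u` is unmatched (the sum has at most one term). -/
def leftOffer (g : ℝ → ℝ) (w : L → R → ℝ) (y : L ⊕ R → ℝ) (M : Finset (L × R)) (u : L) : ℝ :=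
  ∑ e ∈ M with e.1 = u, g (y (Sum.inr e.2)) * w u e.2

/-- The marginal rank `θ (y_v)` of `u`, given the ranks `y` of the vertices other than `u, v`:
`g⁻¹ (g (y_p) * w_{pv} / w_{uv})`, where `(p, v)` belongs to the matching obtained when `u` is
removed and `v` has rank `yv`; extended by `θ (1) = 1`.
It does not depend on the values of `y` at `u` and `v`. -/
noncomputable def theta (g : ℝ → ℝ) (E : Finset (L × R)) (w : L → R → ℝ) (τ : L × R → ℕ)
    (y : L ⊕ R → ℝ) (u : L) (v : R) (yv : ℝ) : ℝ :=
  if yv < 1 then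
    let z := Function.update y (Sum.inr v) yv
    decInv g (rightOffer g w z (matching g (removeLeft E u) w τ z) v / w u v)
  else 1

/-- The marginal rank `β (y_u)` of `v`, symmetric to `theta`. -/
noncomputable def beta (g : ℝ → ℝ) (E : Finset (L × R)) (w : L → R → ℝ) (τ : L × R → ℕ)
    (y : L ⊕ R → ℝ) (u : L) (v : R) (yu : ℝ) : ℝ :=
  if yu < 1 then
    let z := Function.update y (Sum.inl u) yu
    decInv g (leftOffer g w z (matching g (removeRight E v) w τ z) u / w u v)
  else 1

/-- `α` is an admissible choice of the dual variables, as random variables on the space of rank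
vectors: a matched edge is split between its endpoints, each of which gets at least its
guaranteed gain, and unmatched vertices get `0`. -/
structure IsGainSharing (g h : ℝ → ℝ) (E : Finset (L × R)) (w : L → R → ℝ) (τ : L × R → ℕ)
    (α : (L ⊕ R → ℝ) → L ⊕ R → ℝ) : Prop where
  measurable : ∀ x, Measurable fun y => α y x
  left_ge : ∀ y : L ⊕ R → ℝ, (∀ x, y x ∈ Set.Ico (0 : ℝ) 1) → ∀ e ∈ matching g E w τ y,
    h (y (Sum.inl e.1)) * g (y (Sum.inr e.2)) * w e.1 e.2 ≤ α y (Sum.inl e.1)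
  right_ge : ∀ y : L ⊕ R → ℝ, (∀ x, y x ∈ Set.Ico (0 : ℝ) 1) → ∀ e ∈ matching g E w τ y,
    h (y (Sum.inr e.2)) * g (y (Sum.inl e.1)) * w e.1 e.2 ≤ α y (Sum.inr e.2)
  sum_eq : ∀ y : L ⊕ R → ℝ, (∀ x, y x ∈ Set.Ico (0 : ℝ) 1) → ∀ e ∈ matching g E w τ y,
    α y (Sum.inl e.1) + α y (Sum.inr e.2) = w e.1 e.2
  left_unmatched : ∀ y : L ⊕ R → ℝ, (∀ x, y x ∈ Set.Ico (0 : ℝ) 1) → ∀ u : L,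
    (∀ e ∈ matching g E w τ y, e.1 ≠ u) → α y (Sum.inl u) = 0
  right_unmatched : ∀ y : L ⊕ R → ℝ, (∀ x, y x ∈ Set.Ico (0 : ℝ) 1) → ∀ v : R,
    (∀ e ∈ matching g E w τ y, e.2 ≠ v) → α y (Sum.inr v) = 0

/-- `α_u + α_v` as a function of the pair `(y_u, y_v)`, the other ranks being fixed to `y`. -/
def pairGain (α : (L ⊕ R → ℝ) → L ⊕ R → ℝ) (y : L ⊕ R → ℝ) (u : L) (v : R) (p : ℝ × ℝ) : ℝ :=
  α (setRanks y u v p.1 p.2) (Sum.inl u) + α (setRanks y u v p.1 p.2) (Sum.inr v)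

end Algorithm

end QuadraticRanking

/-! Fix the ranks of all other vertices and divide all gains by $w_{uv}$. Two facts hold for every
pair $(y_u,y_v)$.

The first is a floor on each dual. Removing $u$ cannot improve the match of $v$
(`IsGreedy.removal`), so in the full run $v$ is offered at least what it gets without $u$, which is
at least $g(\theta(y_v))w_{uv}$. Hence $\alpha_v\ge h(y_v)g(\theta(y_v))w_{uv}$, and symmetrically
for $u$ (`right_ge_theta`, `left_ge_beta`).

The second is a region of full gain. If $y_u<\theta(y_v)$ and $y_v<\beta(y_u)$, then $(u,v)$
precedes whatever either endpoint would get without the other, so it is matched and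
$\alpha_u+\alpha_v=w_{uv}$ (`mem_matching_of_lt`).

Call this region $A$. The gain is at least $1$ on $A$ and at least the sum of the two floors off
$A$. Raising a rank only postpones the edges at that vertex (`IsGreedy.postpone`), so $\theta$ and
$\beta$ are non-decreasing. Each slice of $A$ is therefore an interval up to endpoints, with length
$(\theta(y_v)-\beta^{-1}(y_v))^+$ or its mirror image, and Fubini gives the bound. -/

namespace QuadraticRanking

/-! ### Greedy matchings for an abstract key -/

section Greedy

variable {ε K A B : Type*} [LinearOrder K]

/-- `M` is the greedy matching of the edge set `E` in the order given by the key `k`; the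
endpoints of an edge are given by `a` and `b`. -/
def IsGreedy (k : ε → K) (a : ε → A) (b : ε → B) (E M : Finset ε) : Prop :=
  ∀ e, e ∈ M ↔ e ∈ E ∧ ∀ f ∈ M, k f < k e → a f ≠ a e ∧ b f ≠ b e

variable {k k' : ε → K} {a : ε → A} {b : ε → B} {E E' M M' : Finset ε}

/-- The two sides play the same role, so each one-sided lemma below also yields its mirror image. -/
theorem IsGreedy.swap (hM : IsGreedy k a b E M) : IsGreedy k b a E M := fun e => by
  rw [hM e]
  simp only [and_comm]

theorem IsGreedy.subset (hM : IsGreedy k a b E M) {e : ε} (he : e ∈ M) : e ∈ E :=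
  ((hM e).1 he).1

theorem IsGreedy.key_eq_of_left (hM : IsGreedy k a b E M) {e f : ε} (he : e ∈ M) (hf : f ∈ M)
    (h : a e = a f) : k e = k f := by
  rcases lt_trichotomy (k e) (k f) with hlt | heq | hlt
  · exact absurd h (((hM f).1 hf).2 e he hlt).1
  · exact heq
  · exact absurd h.symm (((hM e).1 he).2 f hf hlt).1

theorem IsGreedy.key_eq_of_right (hM : IsGreedy k a b E M) {e f : ε} (he : e ∈ M) (hf : f ∈ M)
    (h : b e = b f) : k e = k f :=
  hM.swap.key_eq_of_left he hf h

theorem IsGreedy.exists_blocking (hM : IsGreedy k a b E M) {e : ε} (he : e ∈ E) (heM : e ∉ M) :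
    ∃ f ∈ M, k f < k e ∧ (a f = a e ∨ b f = b e) := by
  by_contra! hcon
  exact heM ((hM e).2 ⟨he, fun f hf hlt => hcon f hf hlt⟩)

variable [Finite ε]

/-- Finiteness of `ε` makes the key order on edges well-founded, whatever `K` is. -/
theorem key_induction (k : ε → K) {p : ε → Prop} (h : ∀ e, (∀ f, k f < k e → p f) → p e)
    (e : ε) : p e := by
  have : IsTrans ε fun e f => k e < k f := ⟨fun _ _ _ => lt_trans⟩
  have : Std.Irrefl fun e f : ε => k e < k f := ⟨fun _ => lt_irrefl _⟩
  exact (Finite.wellFounded_of_trans_of_irrefl fun e f : ε => k e < k f).induction e h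

/-- Two runs of the greedy algorithm agree on a set of edges that is closed under passing to
earlier selected edges. -/
theorem IsGreedy.mem_iff (hM : IsGreedy k a b E M) (hM' : IsGreedy k' a b E' M') (p : ε → Prop)
    (h1 : ∀ e, p e → e ∈ M → e ∈ E') (h2 : ∀ e, p e → e ∈ M' → e ∈ E)
    (h3 : ∀ e, p e → ∀ f ∈ M, k f < k e → p f ∧ k' f < k' e)
    (h4 : ∀ e, p e → ∀ f ∈ M', k' f < k' e → p f ∧ k f < k e) (e : ε) :
    p e → (e ∈ M ↔ e ∈ M') := by
  induction e using key_induction k with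
  | h e ih =>
    intro hp
    constructor
    · intro he
      refine (hM' e).2 ⟨h1 e hp he, fun f hf hlt => ?_⟩
      obtain ⟨hpf, hlt'⟩ := h4 e hp f hf hlt
      exact ((hM e).1 he).2 f ((ih f hlt' hpf).2 hf) hlt'
    · intro he
      refine (hM e).2 ⟨h2 e hp he, fun f hf hlt => ?_⟩
      obtain ⟨hpf, hlt'⟩ := h3 e hp f hf hlt
      exact ((hM' e).1 he).2 f ((ih f hlt hpf).1 hf) hlt'

/-- The greedy matching depends only on the order of the edges of `E`. -/
theorem IsGreedy.eq_of_key_agree (hM : IsGreedy k a b E M) (hM' : IsGreedy k' a b E M')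
    (h : ∀ e ∈ E, ∀ f ∈ E, k f < k e ↔ k' f < k' e) : M = M' := by
  ext e
  have key := hM.mem_iff hM' (· ∈ E) (fun e he _ => he) (fun e he _ => he)
    (fun e he f hf hlt => ⟨hM.subset hf, (h e he f (hM.subset hf)).1 hlt⟩)
    (fun e he f hf hlt => ⟨hM'.subset hf, (h e he f (hM'.subset hf)).2 hlt⟩) e
  exact ⟨fun he => (key (hM.subset he)).1 he, fun he => (key (hM'.subset he)).2 he⟩

/-- Removing a vertex `x` of one side makes the other side worse off
and the rest of its own side better off. -/
theorem IsGreedy.removal (hM : IsGreedy k a b E M) (hM' : IsGreedy k a b E' M') {x : A}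
    (hE' : ∀ e, e ∈ E' ↔ e ∈ E ∧ a e ≠ x) (e : ε) :
    (e ∈ M' → ∃ f ∈ M, b f = b e ∧ k f ≤ k e) ∧
      (e ∈ M → a e ≠ x → ∃ f ∈ M', a f = a e ∧ k f ≤ k e) := by
  -- The two claims support each other: a blocker of `e` that is not itself the required edge is
  -- strictly earlier, and the other claim applies to it.
  induction e using key_induction k with
  | h e ih =>
    constructor
    · intro he
      by_cases heM : e ∈ M
      · exact ⟨e, heM, rfl, le_rfl⟩
      obtain ⟨f, hf, hlt, hfe | hfe⟩ := hM.exists_blocking ((hE' e).1 (hM'.subset he)).1 heM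
      -- In `M'` the vertex `a e` would have an edge no later than `f`. It has the same key as `e`,
      -- yet `f` is strictly earlier than `e`.
      · obtain ⟨f', hf', hff', hle⟩ :=
          (ih f hlt).2 hf (hfe ▸ ((hE' e).1 (hM'.subset he)).2)
        have := hM'.key_eq_of_left hf' he (hff'.trans hfe)
        exact absurd (this ▸ hle) (not_le.2 hlt)
      · exact ⟨f, hf, hfe, hlt.le⟩
    · intro he hx
      by_cases heM : e ∈ M'
      · exact ⟨e, heM, rfl, le_rfl⟩
      obtain ⟨f, hf, hlt, hfe | hfe⟩ :=
        hM'.exists_blocking ((hE' e).2 ⟨hM.subset he, hx⟩) heM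
      · exact ⟨f, hf, hfe, hlt.le⟩
      · obtain ⟨f', hf', hff', hle⟩ := (ih f hlt).1 hf
        have := hM.key_eq_of_right hf' he (hff'.trans hfe)
        exact absurd (this ▸ hle) (not_le.2 hlt)

/-- Postponing the edges at a vertex `x`, without changing their relative order nor that of the
other edges, makes `x` worse off. -/
theorem IsGreedy.postpone (hM : IsGreedy k a b E M) (hM' : IsGreedy k' a b E M')
    (hk' : Function.Injective k') {x : B}
    (hne : ∀ e f, b e ≠ x → b f ≠ x → (k e < k f ↔ k' e < k' f))
    (hpost : ∀ e f, b e ≠ x → b f = x → k e < k f → k' e < k' f)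
    {e : ε} (he : e ∈ M') (hex : b e = x) : ∃ f ∈ M, b f = x ∧ k f ≤ k e := by
  by_contra! hcon
  have heM : e ∉ M := fun h => lt_irrefl _ (hcon e h hex)
  obtain ⟨f, hf, hlt, hfe⟩ := hM.exists_blocking (hM'.subset he) heM
  have hfx : b f ≠ x := fun h => lt_asymm hlt (hcon f hf h)
  have hfe' : a f = a e := hfe.resolve_right fun h => hfx (h.trans hex)
  -- Before `e`, the two runs agree away from `x`: `M` has no edge at `x` that early, and the only
  -- edge of `M'` at `x` is `e`, which still comes later under `k'`. So the blocker `f` of `e` is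
  -- also in `M'`, which is impossible.
  have hiff := hM.mem_iff hM' (fun f => b f ≠ x ∧ k f < k e)
    (fun _ _ h => hM.subset h) (fun _ _ h => hM'.subset h)
    (fun f' hf' f'' hf'' hlt' => by
      have hb : b f'' ≠ x := fun h => lt_asymm (hlt'.trans hf'.2) (hcon f'' hf'' h)
      exact ⟨⟨hb, hlt'.trans hf'.2⟩, (hne _ _ hb hf'.1).1 hlt'⟩)
    (fun f' hf' f'' hf'' hlt' => by
      have hb : b f'' ≠ x := fun h => by
        have : f'' = e := hk' (hM'.key_eq_of_right hf'' he (h.trans hex.symm))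
        subst this
        exact lt_asymm hlt' (hpost f' f'' hf'.1 hex hf'.2)
      have hlt'' := (hne _ _ hb hf'.1).2 hlt'
      exact ⟨⟨hb, hlt''.trans hf'.2⟩, hlt''⟩) f ⟨hfx, hlt⟩
  exact (((hM' e).1 he).2 f (hiff.1 hf) (hpost f e hfx hex hlt)).1 hfe'

/-- A selected edge `f` stays selected after the removal of a vertex `x` that no selected edge up
to `f` meets. -/
theorem IsGreedy.mem_removal_of_first (hM : IsGreedy k a b E M) (hM' : IsGreedy k a b E' M')
    {x : B} (hE' : ∀ e, e ∈ E' ↔ e ∈ E ∧ b e ≠ x) {f : ε} (hf : f ∈ M)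
    (hfirst : ∀ e ∈ M, k e ≤ k f → b e ≠ x) : f ∈ M' :=
  (hM.mem_iff hM' (fun e => k e ≤ k f)
    (fun e he heM => (hE' e).2 ⟨hM.subset heM, hfirst e heM he⟩)
    (fun e _ heM => ((hE' e).1 (hM'.subset heM)).1)
    (fun _ he _ _ hlt => ⟨hlt.le.trans he, hlt⟩)
    (fun _ he _ _ hlt => ⟨hlt.le.trans he, hlt⟩) f le_rfl).1 hf

/-- An edge that precedes the edges selected at each of its endpoints when the other endpoint is
removed is selected. -/
theorem IsGreedy.mem_of_lt {Ma Mb Ea Eb : Finset ε} {e₀ : ε} (hM : IsGreedy k a b E M)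
    (hMa : IsGreedy k a b Ea Ma) (hMb : IsGreedy k a b Eb Mb) (hk : Function.Injective k)
    (hEa : ∀ e, e ∈ Ea ↔ e ∈ E ∧ a e ≠ a e₀) (hEb : ∀ e, e ∈ Eb ↔ e ∈ E ∧ b e ≠ b e₀)
    (he₀ : e₀ ∈ E) (huniq : ∀ e, a e = a e₀ → b e = b e₀ → e = e₀)
    (ha : ∀ f ∈ Ma, b f = b e₀ → k e₀ < k f) (hb : ∀ f ∈ Mb, a f = a e₀ → k e₀ < k f) :
    e₀ ∈ M := by
  by_contra hcon
  -- Consider the earliest selected edge `f` at an endpoint of `e₀`, supposed to precede `e₀`. It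
  -- meets only one endpoint, so it survives removal of the other one and contradicts `ha` or `hb`.
  have key : ∀ f, f ∈ M → (a f = a e₀ ∨ b f = b e₀) → ¬ k f < k e₀ := by
    intro f
    induction f using key_induction k with
    | h f ih =>
      intro hf hfe hlt
      have hmin : ∀ e ∈ M, k e ≤ k f → (a e = a e₀ ∨ b e = b e₀) → e = f := by
        intro e he hle hee
        rcases hle.lt_or_eq with h | h
        · exact absurd (h.trans hlt) (ih e h he hee)
        · exact hk h
      have hne : ¬ (a f = a e₀ ∧ b f = b e₀) := fun h =>
        lt_irrefl _ ((huniq f h.1 h.2) ▸ hlt)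
      rcases hfe with h | h
      · refine lt_asymm hlt (hb f (hM.mem_removal_of_first hMb hEb hf ?_) h)
        intro e he hle hbe
        have := hmin e he hle (Or.inr hbe)
        exact hne ⟨h, this ▸ hbe⟩
      · refine lt_asymm hlt (ha f (hM.swap.mem_removal_of_first hMa.swap hEa hf ?_) h)
        intro e he hle hae
        have := hmin e he hle (Or.inl hae)
        exact hne ⟨this ▸ hae, h⟩
  obtain ⟨f, hf, hlt, hfe⟩ := hM.exists_blocking he₀ hcon
  exact key f hf hfe hlt

end Greedy

/-! ### The algorithm as a greedy matching -/

section Algorithm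

variable {L R : Type*}

/-- The pairs are queried in the increasing order of this key. -/
noncomputable def queryKey (g : ℝ → ℝ) (w : L → R → ℝ) (τ : L × R → ℕ) (y : L ⊕ R → ℝ)
    (e : L × R) : ℝ ×ₗ ℕ :=
  toLex (-perturbedWeight g w y e, τ e)

variable {g : ℝ → ℝ} {w : L → R → ℝ} {τ : L × R → ℕ} {y z : L ⊕ R → ℝ} {E : Finset (L × R)}

theorem queryKey_le_iff {e f : L × R} :
    queryKey g w τ y e ≤ queryKey g w τ y f ↔ QueriedBefore g w τ y e f := by
  simp [queryKey, QueriedBefore, Prod.Lex.le_iff]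

theorem queryKey_lt_iff {e f : L × R} :
    queryKey g w τ y e < queryKey g w τ y f ↔
      perturbedWeight g w y f < perturbedWeight g w y e ∨
        (perturbedWeight g w y e = perturbedWeight g w y f ∧ τ e < τ f) := by
  simp [queryKey, Prod.Lex.lt_iff]

theorem queryKey_injective (hτ : Function.Injective τ) :
    Function.Injective (queryKey g w τ y) := fun e f h => by
  have : (-perturbedWeight g w y e, τ e) = (-perturbedWeight g w y f, τ f) := toLex.injective h
  exact hτ (Prod.ext_iff.1 this).2

theorem perturbedWeight_le_of_queryKey_le {e f : L × R}
    (h : queryKey g w τ y e ≤ queryKey g w τ y f) :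
    perturbedWeight g w y f ≤ perturbedWeight g w y e := by
  rcases queryKey_le_iff.1 h with h | h
  · exact h.le
  · exact h.1.ge

variable [Fintype L] [Fintype R] [DecidableEq L] [DecidableEq R]

/-- The last pair of the list comes after every pair selected before it. It cannot affect the
criterion for earlier pairs, and its own criterion ranges over the whole current matching. -/
theorem mem_foldl_queryStep (l : List (L × R)) :
    l.Pairwise (fun e f => queryKey g w τ y e < queryKey g w τ y f) → ∀ e,
      (e ∈ l.foldl (queryStep E) ∅ ↔ e ∈ l ∧ e ∈ E ∧ ∀ f ∈ l.foldl (queryStep E) ∅,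
        queryKey g w τ y f < queryKey g w τ y e → f.1 ≠ e.1 ∧ f.2 ≠ e.2) := by
  induction l using List.reverseRecOn with
  | nil => simp
  | append_singleton l x ih =>
    intro hl e
    rw [List.pairwise_append] at hl
    have hlx : ∀ f ∈ l, queryKey g w τ y f < queryKey g w τ y x := fun f hf =>
      hl.2.2 f hf x (List.mem_singleton_self x)
    specialize ih hl.1
    set M := l.foldl (queryStep E) ∅ with hMdef
    have hMl : ∀ f ∈ M, f ∈ l := fun f hf => ((ih f).1 hf).1
    have hxM : x ∉ M := fun h => lt_irrefl _ (hlx x (hMl x h))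
    rw [List.foldl_append, List.foldl_cons, List.foldl_nil, ← hMdef]
    have hmem : ∀ f, f ∈ queryStep E M x ↔
        f ∈ M ∨ (f = x ∧ x ∈ E ∧ ∀ f ∈ M, f.1 ≠ x.1 ∧ f.2 ≠ x.2) := by
      intro f
      unfold queryStep
      split_ifs with h
      · rw [Finset.mem_insert]; tauto
      · tauto
    rcases eq_or_ne e x with rfl | hne
    · constructor
      · intro he
        rcases (hmem e).1 he with h | ⟨-, hE, h⟩
        · exact absurd h hxM
        · refine ⟨by simp, hE, fun f hf hlt => ?_⟩
          rcases (hmem f).1 hf with hf | ⟨rfl, -⟩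
          · exact h f hf
          · exact absurd hlt (lt_irrefl _)
      · rintro ⟨-, hE, h⟩
        exact (hmem e).2 (Or.inr ⟨rfl, hE, fun f hf =>
          h f ((hmem f).2 (Or.inl hf)) (hlx f (hMl f hf))⟩)
    · have h1 : e ∈ queryStep E M x ↔ e ∈ M := by
        rw [hmem]; tauto
      rw [h1, ih e]
      constructor
      · rintro ⟨hel, hE, h⟩
        refine ⟨by simp [hel], hE, fun f hf hlt => ?_⟩
        rcases (hmem f).1 hf with hf | ⟨rfl, -⟩
        · exact h f hf hlt
        · exact absurd hlt (lt_asymm (hlx e hel))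
      · rintro ⟨hel, hE, h⟩
        refine ⟨?_, hE, fun f hf hlt => h f ((hmem f).2 (Or.inl hf)) hlt⟩
        simpa [hne] using hel

/-- Passes from the list-based algorithm to `IsGreedy`. The sorted list is strictly increasing
because it has no duplicates and injectivity of `τ` excludes equal keys. -/
theorem isGreedy_matching (hτ : Function.Injective τ) (E : Finset (L × R)) (y : L ⊕ R → ℝ) :
    IsGreedy (queryKey g w τ y) Prod.fst Prod.snd E (matching g E w τ y) := by
  have : IsTrans (L × R) (QueriedBefore g w τ y) := ⟨fun e f e' h1 h2 =>
    queryKey_le_iff.1 ((queryKey_le_iff.2 h1).trans (queryKey_le_iff.2 h2))⟩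
  have : Std.Total (QueriedBefore g w τ y) := ⟨fun e f =>
    (le_total (queryKey g w τ y e) (queryKey g w τ y f)).imp queryKey_le_iff.1
      queryKey_le_iff.1⟩
  have hnd : (queryOrder g w τ y).Nodup :=
    (List.perm_insertionSort _ _).nodup_iff.2 (Finset.nodup_toList _)
  have hle : (queryOrder g w τ y).Pairwise (QueriedBefore g w τ y) :=
    List.pairwise_insertionSort _ _
  have hlt : (queryOrder g w τ y).Pairwise
      (fun e f => queryKey g w τ y e < queryKey g w τ y f) := by
    refine (hle.and hnd).imp ?_
    rintro e f ⟨h1, h2⟩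
    exact (queryKey_le_iff.2 h1).lt_of_ne fun h => h2 (queryKey_injective hτ h)
  intro e
  have := mem_foldl_queryStep (E := E) _ hlt e
  rw [matching, this]
  simp [queryOrder]

end Algorithm

end QuadraticRanking

set_option linter.unusedSectionVars false

namespace QuadraticRanking

/-! ### The inverse of a non-increasing function -/

section DecInv

variable {g : ℝ → ℝ} {c c' x : ℝ}

theorem bddBelow_decInv (g : ℝ → ℝ) (c : ℝ) :
    BddBelow (insert 1 {x : ℝ | x ∈ Set.Icc (0 : ℝ) 1 ∧ g x ≤ c}) :=
  ⟨0, by rintro x (rfl | hx); exacts [zero_le_one, hx.1.1]⟩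

theorem decInv_mem_Icc (g : ℝ → ℝ) (c : ℝ) : decInv g c ∈ Set.Icc (0 : ℝ) 1 := by
  refine ⟨le_csInf (Set.insert_nonempty _ _) ?_,
    csInf_le (bddBelow_decInv g c) (Set.mem_insert _ _)⟩
  rintro x (rfl | hx)
  exacts [zero_le_one, hx.1.1]

theorem decInv_anti (h : c ≤ c') : decInv g c' ≤ decInv g c := by
  refine csInf_le_csInf (bddBelow_decInv g c') (Set.insert_nonempty _ _) ?_
  exact Set.insert_subset_insert fun x hx => ⟨hx.1, hx.2.trans h⟩

theorem lt_of_lt_decInv (hx : x ∈ Set.Icc (0 : ℝ) 1) (h : x < decInv g c) : c < g x := by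
  by_contra! hle
  exact absurd (csInf_le (bddBelow_decInv g c) (Set.mem_insert_of_mem _ ⟨hx, hle⟩)) (not_le.2 h)

/-- The infimum is a limit of points to its right where `g ≤ c`, so right-continuity gives the bound
there too. The inserted point `1` qualifies because `g 1 = 0 ≤ c`. -/
theorem apply_decInv_le (hg1 : g 1 = 0)
    (hg : ∀ y ∈ Set.Icc (0 : ℝ) 1, ContinuousWithinAt g (Set.Icc y 1) y) (hc : 0 ≤ c) :
    g (decInv g c) ≤ c := by
  set S := insert 1 {x : ℝ | x ∈ Set.Icc (0 : ℝ) 1 ∧ g x ≤ c} with hS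
  set s := decInv g c with hs
  have hsub : S ⊆ Set.Icc s 1 := by
    intro x hx
    refine ⟨csInf_le (bddBelow_decInv g c) hx, ?_⟩
    rcases hx with rfl | hx
    exacts [le_rfl, hx.1.2]
  have hle : ∀ x ∈ S, g x ≤ c := by
    rintro x (rfl | hx)
    exacts [hg1.trans_le hc, hx.2]
  have hcl : s ∈ closure S := csInf_mem_closure (Set.insert_nonempty _ _) (bddBelow_decInv g c)
  have hcont := (hg s (decInv_mem_Icc g c)).mono hsub
  have := hcont.mem_closure hcl (t := Set.Iic c) hle
  rwa [isClosed_Iic.closure_eq] at this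

end DecInv

/-! ### Offers and how they depend on ranks and removals -/

section Offers

variable {L R : Type*} [Fintype L] [Fintype R] [DecidableEq L] [DecidableEq R]
variable {g h : ℝ → ℝ} {w : L → R → ℝ} {τ : L × R → ℕ} {y z : L ⊕ R → ℝ}
variable {E M : Finset (L × R)} {u : L} {v : R}

theorem IsParam.g_nonneg (hgh : IsParam g h) {x : ℝ} (hx : x ∈ Set.Icc (0 : ℝ) 1) : 0 ≤ g x := by
  rcases hx.2.lt_or_eq with hlt | rfl
  · exact (hgh.g_pos x ⟨hx.1, hlt⟩).le
  · exact hgh.g_one.ge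

theorem rightOffer_nonneg (hgh : IsParam g h) (hw : ∀ a b, 0 ≤ w a b)
    (hy : ∀ x, y x ∈ Set.Ico (0 : ℝ) 1) : 0 ≤ rightOffer g w y M v :=
  Finset.sum_nonneg fun _ _ => mul_nonneg (hgh.g_pos _ (hy _)).le (hw _ _)

theorem leftOffer_nonneg (hgh : IsParam g h) (hw : ∀ a b, 0 ≤ w a b)
    (hy : ∀ x, y x ∈ Set.Ico (0 : ℝ) 1) : 0 ≤ leftOffer g w y M u :=
  Finset.sum_nonneg fun _ _ => mul_nonneg (hgh.g_pos _ (hy _)).le (hw _ _)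

theorem rightOffer_eq_zero (hM : ∀ e ∈ M, e.2 ≠ v) : rightOffer g w y M v = 0 := by
  rw [rightOffer, Finset.filter_eq_empty_iff.2 fun e he => hM e he, Finset.sum_empty]

theorem leftOffer_eq_zero (hM : ∀ e ∈ M, e.1 ≠ u) : leftOffer g w y M u = 0 := by
  rw [leftOffer, Finset.filter_eq_empty_iff.2 fun e he => hM e he, Finset.sum_empty]

theorem rightOffer_matching (hτ : Function.Injective τ) {e : L × R}
    (he : e ∈ matching g E w τ z) (hev : e.2 = v) :
    rightOffer g w y (matching g E w τ z) v = g (y (Sum.inl e.1)) * w e.1 v := by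
  refine Finset.sum_eq_single_of_mem e (Finset.mem_filter.2 ⟨he, hev⟩) fun f hf hne => ?_
  rw [Finset.mem_filter] at hf
  exact absurd (queryKey_injective hτ
    ((isGreedy_matching hτ E z).key_eq_of_right hf.1 he (hf.2.trans hev.symm))) hne

theorem leftOffer_matching (hτ : Function.Injective τ) {e : L × R}
    (he : e ∈ matching g E w τ z) (heu : e.1 = u) :
    leftOffer g w y (matching g E w τ z) u = g (y (Sum.inr e.2)) * w u e.2 := by
  refine Finset.sum_eq_single_of_mem e (Finset.mem_filter.2 ⟨he, heu⟩) fun f hf hne => ?_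
  rw [Finset.mem_filter] at hf
  exact absurd (queryKey_injective hτ
    ((isGreedy_matching hτ E z).key_eq_of_left hf.1 he (hf.2.trans heu.symm))) hne

theorem queryKey_congr {e : L × R} (h1 : y (Sum.inl e.1) = z (Sum.inl e.1))
    (h2 : y (Sum.inr e.2) = z (Sum.inr e.2)) : queryKey g w τ y e = queryKey g w τ z e := by
  simp [queryKey, perturbedWeight, h1, h2]

theorem mem_removeLeft {e : L × R} : e ∈ removeLeft E u ↔ e ∈ E ∧ e.1 ≠ u :=
  Finset.mem_filter

theorem mem_removeRight {e : L × R} : e ∈ removeRight E v ↔ e ∈ E ∧ e.2 ≠ v :=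
  Finset.mem_filter

/-- The run without `u` does not depend on the rank of `u`. -/
theorem matching_removeLeft_congr (hτ : Function.Injective τ)
    (hyz : ∀ x, x ≠ Sum.inl u → y x = z x) :
    matching g (removeLeft E u) w τ y = matching g (removeLeft E u) w τ z := by
  refine (isGreedy_matching hτ _ y).eq_of_key_agree (isGreedy_matching hτ _ z) ?_
  intro e he f hf
  have key : ∀ e ∈ removeLeft E u, queryKey g w τ y e = queryKey g w τ z e := fun e he =>
    queryKey_congr (hyz _ fun h => (mem_removeLeft.1 he).2 (Sum.inl_injective h))
      (hyz _ Sum.inr_ne_inl)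
  rw [key e he, key f hf]

theorem matching_removeRight_congr (hτ : Function.Injective τ)
    (hyz : ∀ x, x ≠ Sum.inr v → y x = z x) :
    matching g (removeRight E v) w τ y = matching g (removeRight E v) w τ z := by
  refine (isGreedy_matching hτ _ y).eq_of_key_agree (isGreedy_matching hτ _ z) ?_
  intro e he f hf
  have key : ∀ e ∈ removeRight E v, queryKey g w τ y e = queryKey g w τ z e := fun e he =>
    queryKey_congr (hyz _ Sum.inl_ne_inr)
      (hyz _ fun h => (mem_removeRight.1 he).2 (Sum.inr_injective h))
  rw [key e he, key f hf]

theorem rightOffer_removeLeft_congr (hτ : Function.Injective τ)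
    (hyz : ∀ x, x ≠ Sum.inl u → y x = z x) :
    rightOffer g w y (matching g (removeLeft E u) w τ y) v =
      rightOffer g w z (matching g (removeLeft E u) w τ z) v := by
  rw [matching_removeLeft_congr hτ hyz]
  refine Finset.sum_congr rfl fun e he => ?_
  have he' := (isGreedy_matching hτ _ z).subset (Finset.mem_filter.1 he).1
  rw [hyz _ fun h => (mem_removeLeft.1 he').2 (Sum.inl_injective h)]

theorem leftOffer_removeRight_congr (hτ : Function.Injective τ)
    (hyz : ∀ x, x ≠ Sum.inr v → y x = z x) :
    leftOffer g w y (matching g (removeRight E v) w τ y) u =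
      leftOffer g w z (matching g (removeRight E v) w τ z) u := by
  rw [matching_removeRight_congr hτ hyz]
  refine Finset.sum_congr rfl fun e he => ?_
  have he' := (isGreedy_matching hτ _ z).subset (Finset.mem_filter.1 he).1
  rw [hyz _ fun h => (mem_removeRight.1 he').2 (Sum.inr_injective h)]

theorem setRanks_inl : setRanks y u v s t (Sum.inl u) = s := by
  simp [setRanks]

theorem setRanks_inr : setRanks y u v s t (Sum.inr v) = t := by
  simp [setRanks]

theorem setRanks_mem (hy : ∀ x, y x ∈ Set.Ico (0 : ℝ) 1) {s t : ℝ} (hs : s ∈ Set.Ico (0 : ℝ) 1)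
    (ht : t ∈ Set.Ico (0 : ℝ) 1) (x : L ⊕ R) : setRanks y u v s t x ∈ Set.Ico (0 : ℝ) 1 := by
  simp only [setRanks, Function.update_apply]
  split_ifs
  exacts [ht, hs, hy x]

/-- The rank `s` of `u` is irrelevant once `u` is removed, so the marginal rank can be read off the
same rank vector as the full run. -/
theorem theta_eq (hτ : Function.Injective τ) {s t : ℝ} (ht : t < 1) :
    theta g E w τ y u v t = decInv g (rightOffer g w (setRanks y u v s t)
      (matching g (removeLeft E u) w τ (setRanks y u v s t)) v / w u v) := by
  rw [theta, if_pos ht]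
  dsimp only
  rw [rightOffer_removeLeft_congr hτ (z := setRanks y u v s t)]
  intro x hx
  simp [setRanks, Function.update_apply, hx]

theorem beta_eq (hτ : Function.Injective τ) {s t : ℝ} (hs : s < 1) :
    beta g E w τ y u v s = decInv g (leftOffer g w (setRanks y u v s t)
      (matching g (removeRight E v) w τ (setRanks y u v s t)) u / w u v) := by
  rw [beta, if_pos hs]
  dsimp only
  rw [leftOffer_removeRight_congr hτ (z := setRanks y u v s t)]
  intro x hx
  simp [setRanks, Function.update_apply, hx]

/-- The offer to the right vertex of `e`, as a factor of the perturbed weight. -/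
theorem perturbedWeight_eq_right {e : L × R} (hev : e.2 = v) : perturbedWeight g w y e =
    g (y (Sum.inr v)) * (g (y (Sum.inl e.1)) * w e.1 v) := by
  subst hev
  rw [perturbedWeight]; ring

theorem perturbedWeight_eq_left {e : L × R} (heu : e.1 = u) : perturbedWeight g w y e =
    g (y (Sum.inl u)) * (g (y (Sum.inr e.2)) * w u e.2) := by
  subst heu
  rw [perturbedWeight]; ring

/-- With `u` present, `v` is matched no later. Both perturbed weights carry the factor $g(y_v)$,
which is positive because ranks are below $1$, and it cancels. -/
theorem rightOffer_removeLeft_le (hgh : IsParam g h) (hw : ∀ a b, 0 ≤ w a b)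
    (hτ : Function.Injective τ) (hy : ∀ x, y x ∈ Set.Ico (0 : ℝ) 1) :
    rightOffer g w y (matching g (removeLeft E u) w τ y) v ≤
      rightOffer g w y (matching g E w τ y) v := by
  by_cases hex : ∃ e ∈ matching g (removeLeft E u) w τ y, e.2 = v
  · obtain ⟨e, he, hev⟩ := hex
    obtain ⟨f, hf, hfe, hle⟩ := ((isGreedy_matching hτ E y).removal (isGreedy_matching hτ _ y)
      (fun e => mem_removeLeft (u := u)) e).1 he
    have hfv : f.2 = v := hfe.trans hev
    have := perturbedWeight_le_of_queryKey_le hle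
    rw [perturbedWeight_eq_right hfv, perturbedWeight_eq_right hev] at this
    rw [rightOffer_matching hτ he hev, rightOffer_matching hτ hf hfv]
    exact le_of_mul_le_mul_left this (hgh.g_pos _ (hy _))
  · push Not at hex
    rw [rightOffer_eq_zero hex]
    exact rightOffer_nonneg hgh hw hy

theorem leftOffer_removeRight_le (hgh : IsParam g h) (hw : ∀ a b, 0 ≤ w a b)
    (hτ : Function.Injective τ) (hy : ∀ x, y x ∈ Set.Ico (0 : ℝ) 1) :
    leftOffer g w y (matching g (removeRight E v) w τ y) u ≤
      leftOffer g w y (matching g E w τ y) u := by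
  by_cases hex : ∃ e ∈ matching g (removeRight E v) w τ y, e.1 = u
  · obtain ⟨e, he, heu⟩ := hex
    obtain ⟨f, hf, hfe, hle⟩ := ((isGreedy_matching hτ E y).swap.removal
      (isGreedy_matching hτ _ y).swap (fun e => mem_removeRight (v := v)) e).1 he
    have hfu : f.1 = u := hfe.trans heu
    have := perturbedWeight_le_of_queryKey_le hle
    rw [perturbedWeight_eq_left hfu, perturbedWeight_eq_left heu] at this
    rw [leftOffer_matching hτ he heu, leftOffer_matching hτ hf hfu]
    exact le_of_mul_le_mul_left this (hgh.g_pos _ (hy _))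
  · push Not at hex
    rw [leftOffer_eq_zero hex]
    exact leftOffer_nonneg hgh hw hy

/-- Lowering a perturbed weight can only postpone a pair, since the tie-breaking index is unchanged.
This supplies `hpost` in `IsGreedy.postpone`. -/
theorem queryKey_lt_of_perturbedWeight {e f : L × R}
    (he : queryKey g w τ y e = queryKey g w τ z e)
    (hf : perturbedWeight g w z f ≤ perturbedWeight g w y f)
    (h : queryKey g w τ y e < queryKey g w τ y f) :
    queryKey g w τ z e < queryKey g w τ z f := by
  rw [← he]
  refine h.trans_le ?_
  simpa [queryKey, Prod.Lex.le_iff, eq_comm] using hf.lt_or_eq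

/-- The offer to a right vertex does not increase with its rank. -/
theorem rightOffer_anti (hgh : IsParam g h) (hw : ∀ a b, 0 ≤ w a b)
    (hτ : Function.Injective τ) (hy : ∀ x, y x ∈ Set.Ico (0 : ℝ) 1)
    (hz : ∀ x, z x ∈ Set.Ico (0 : ℝ) 1) (hyz : ∀ x, x ≠ Sum.inr v → y x = z x)
    (hv : y (Sum.inr v) ≤ z (Sum.inr v)) :
    rightOffer g w z (matching g E w τ z) v ≤ rightOffer g w y (matching g E w τ y) v := by
  by_cases hex : ∃ e ∈ matching g E w τ z, e.2 = v
  · obtain ⟨e, he, hev⟩ := hex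
    have hkey : ∀ e : L × R, e.2 ≠ v → queryKey g w τ y e = queryKey g w τ z e := fun e he =>
      queryKey_congr (hyz _ Sum.inl_ne_inr) (hyz _ fun h => he (Sum.inr_injective h))
    obtain ⟨f, hf, hfv, hle⟩ := (isGreedy_matching hτ E y).postpone (isGreedy_matching hτ E z)
      (queryKey_injective hτ) (x := v)
      (fun e f he hf => by rw [hkey e he, hkey f hf])
      (fun e f he hf => queryKey_lt_of_perturbedWeight (hkey e he) (by
        rw [perturbedWeight_eq_right hf, perturbedWeight_eq_right hf, hyz _ Sum.inl_ne_inr]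
        exact mul_le_mul_of_nonneg_right
          (hgh.g_anti (Set.Ico_subset_Icc_self (hy _)) (Set.Ico_subset_Icc_self (hz _)) hv)
          (mul_nonneg (hgh.g_pos _ (hz _)).le (hw _ _)))) he hev
    -- Both edges are compared under `y`, so the factor $g(y_v)$ is common. The offer does not
    -- involve the rank of `v` and is thus the same under `z`.
    have := perturbedWeight_le_of_queryKey_le hle
    rw [perturbedWeight_eq_right hfv, perturbedWeight_eq_right hev] at this
    rw [rightOffer_matching hτ he hev, rightOffer_matching hτ hf hfv, ← hyz _ Sum.inl_ne_inr]
    exact le_of_mul_le_mul_left this (hgh.g_pos _ (hy _))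
  · push Not at hex
    rw [rightOffer_eq_zero hex]
    exact rightOffer_nonneg hgh hw hy

theorem leftOffer_anti (hgh : IsParam g h) (hw : ∀ a b, 0 ≤ w a b)
    (hτ : Function.Injective τ) (hy : ∀ x, y x ∈ Set.Ico (0 : ℝ) 1)
    (hz : ∀ x, z x ∈ Set.Ico (0 : ℝ) 1) (hyz : ∀ x, x ≠ Sum.inl u → y x = z x)
    (hu : y (Sum.inl u) ≤ z (Sum.inl u)) :
    leftOffer g w z (matching g E w τ z) u ≤ leftOffer g w y (matching g E w τ y) u := by
  by_cases hex : ∃ e ∈ matching g E w τ z, e.1 = u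
  · obtain ⟨e, he, heu⟩ := hex
    have hkey : ∀ e : L × R, e.1 ≠ u → queryKey g w τ y e = queryKey g w τ z e := fun e he =>
      queryKey_congr (hyz _ fun h => he (Sum.inl_injective h)) (hyz _ Sum.inr_ne_inl)
    obtain ⟨f, hf, hfu, hle⟩ := (isGreedy_matching hτ E y).swap.postpone
      (isGreedy_matching hτ E z).swap (queryKey_injective hτ) (x := u)
      (fun e f he hf => by rw [hkey e he, hkey f hf])
      (fun e f he hf => queryKey_lt_of_perturbedWeight (hkey e he) (by
        rw [perturbedWeight_eq_left hf, perturbedWeight_eq_left hf, hyz _ Sum.inr_ne_inl]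
        exact mul_le_mul_of_nonneg_right
          (hgh.g_anti (Set.Ico_subset_Icc_self (hy _)) (Set.Ico_subset_Icc_self (hz _)) hu)
          (mul_nonneg (hgh.g_pos _ (hz _)).le (hw _ _)))) he heu
    have := perturbedWeight_le_of_queryKey_le hle
    rw [perturbedWeight_eq_left hfu, perturbedWeight_eq_left heu] at this
    rw [leftOffer_matching hτ he heu, leftOffer_matching hτ hf hfu, ← hyz _ Sum.inr_ne_inl]
    exact le_of_mul_le_mul_left this (hgh.g_pos _ (hy _))
  · push Not at hex
    rw [leftOffer_eq_zero hex]
    exact leftOffer_nonneg hgh hw hy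

/-! ### Monotonicity of the marginal ranks -/

theorem theta_mem_Icc (x : ℝ) : theta g E w τ y u v x ∈ Set.Icc (0 : ℝ) 1 := by
  rw [theta]
  split_ifs
  exacts [decInv_mem_Icc _ _, ⟨zero_le_one, le_rfl⟩]

theorem beta_mem_Icc (x : ℝ) : beta g E w τ y u v x ∈ Set.Icc (0 : ℝ) 1 := by
  rw [beta]
  split_ifs
  exacts [decInv_mem_Icc _ _, ⟨zero_le_one, le_rfl⟩]

/-- Two order reversals compose: the offer falls as the rank of `v` rises, and `decInv` is antitone.
At the endpoint, the convention $\theta(1)=1$ is the largest possible value. -/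
theorem theta_monotoneOn (hgh : IsParam g h) (hw : ∀ a b, 0 ≤ w a b)
    (hτ : Function.Injective τ) (hy : ∀ x, y x ∈ Set.Ico (0 : ℝ) 1) :
    MonotoneOn (theta g E w τ y u v) (Set.Icc 0 1) := by
  intro s hs t ht hst
  rcases ht.2.lt_or_eq with ht1 | rfl
  · have h0 : (0 : ℝ) ∈ Set.Ico (0 : ℝ) 1 := by simp
    rw [theta_eq hτ (s := 0) (hst.trans_lt ht1), theta_eq hτ (s := 0) ht1]
    refine decInv_anti (div_le_div_of_nonneg_right ?_ (hw u v))
    refine rightOffer_anti hgh hw hτ (setRanks_mem hy h0 ⟨hs.1, hst.trans_lt ht1⟩)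
      (setRanks_mem hy h0 ⟨ht.1, ht1⟩) (fun x hx => ?_) (by simpa [setRanks_inr])
    simp [setRanks, hx]
  · refine (theta_mem_Icc s).2.trans_eq ?_
    simp [theta]

theorem beta_monotoneOn (hgh : IsParam g h) (hw : ∀ a b, 0 ≤ w a b)
    (hτ : Function.Injective τ) (hy : ∀ x, y x ∈ Set.Ico (0 : ℝ) 1) :
    MonotoneOn (beta g E w τ y u v) (Set.Icc 0 1) := by
  intro s hs t ht hst
  rcases ht.2.lt_or_eq with ht1 | rfl
  · have h0 : (0 : ℝ) ∈ Set.Ico (0 : ℝ) 1 := by simp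
    rw [beta_eq hτ (t := 0) (hst.trans_lt ht1), beta_eq hτ (t := 0) ht1]
    refine decInv_anti (div_le_div_of_nonneg_right ?_ (hw u v))
    refine leftOffer_anti hgh hw hτ (setRanks_mem hy ⟨hs.1, hst.trans_lt ht1⟩ h0)
      (setRanks_mem hy ⟨ht.1, ht1⟩ h0) (fun x hx => ?_) (by simpa [setRanks_inl])
    simp [setRanks, Function.update_apply, hx]
  · refine (beta_mem_Icc s).2.trans_eq ?_
    simp [beta]

/-! ### Bounds on the dual variables -/

variable {α : (L ⊕ R → ℝ) → L ⊕ R → ℝ}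

theorem IsGainSharing.rightOffer_le (hα : IsGainSharing g h E w τ α)
    (hτ : Function.Injective τ) (hy : ∀ x, y x ∈ Set.Ico (0 : ℝ) 1) :
    h (y (Sum.inr v)) * rightOffer g w y (matching g E w τ y) v ≤ α y (Sum.inr v) := by
  by_cases hex : ∃ e ∈ matching g E w τ y, e.2 = v
  · obtain ⟨e, he, rfl⟩ := hex
    rw [rightOffer_matching hτ he rfl, ← mul_assoc]
    exact hα.right_ge y hy e he
  · push Not at hex
    rw [rightOffer_eq_zero hex, mul_zero, hα.right_unmatched y hy v hex]

theorem IsGainSharing.leftOffer_le (hα : IsGainSharing g h E w τ α)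
    (hτ : Function.Injective τ) (hy : ∀ x, y x ∈ Set.Ico (0 : ℝ) 1) :
    h (y (Sum.inl u)) * leftOffer g w y (matching g E w τ y) u ≤ α y (Sum.inl u) := by
  by_cases hex : ∃ e ∈ matching g E w τ y, e.1 = u
  · obtain ⟨e, he, rfl⟩ := hex
    rw [leftOffer_matching hτ he rfl, ← mul_assoc]
    exact hα.left_ge y hy e he
  · push Not at hex
    rw [leftOffer_eq_zero hex, mul_zero, hα.left_unmatched y hy u hex]

theorem IsGainSharing.right_nonneg (hα : IsGainSharing g h E w τ α) (hgh : IsParam g h)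
    (hw : ∀ a b, 0 ≤ w a b) (hτ : Function.Injective τ)
    (hy : ∀ x, y x ∈ Set.Ico (0 : ℝ) 1) (v : R) : 0 ≤ α y (Sum.inr v) :=
  (mul_nonneg (hgh.h_pos _ (Set.Ico_subset_Icc_self (hy _))).le
    (rightOffer_nonneg hgh hw hy)).trans (hα.rightOffer_le hτ hy)

theorem IsGainSharing.left_nonneg (hα : IsGainSharing g h E w τ α) (hgh : IsParam g h)
    (hw : ∀ a b, 0 ≤ w a b) (hτ : Function.Injective τ)
    (hy : ∀ x, y x ∈ Set.Ico (0 : ℝ) 1) (u : L) : 0 ≤ α y (Sum.inl u) :=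
  (mul_nonneg (hgh.h_pos _ (Set.Ico_subset_Icc_self (hy _))).le
    (leftOffer_nonneg hgh hw hy)).trans (hα.leftOffer_le hτ hy)

/-- A crude bound by the total weight, used only for integrability. -/
theorem IsGainSharing.right_le (hα : IsGainSharing g h E w τ α) (hgh : IsParam g h)
    (hw : ∀ a b, 0 ≤ w a b) (hτ : Function.Injective τ)
    (hy : ∀ x, y x ∈ Set.Ico (0 : ℝ) 1) (v : R) : α y (Sum.inr v) ≤ ∑ a, ∑ b, w a b := by
  by_cases hex : ∃ e ∈ matching g E w τ y, e.2 = v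
  · obtain ⟨e, he, rfl⟩ := hex
    have h1 := hα.sum_eq y hy e he
    have h2 := hα.left_nonneg hgh hw hτ hy e.1
    have h3 : w e.1 e.2 ≤ ∑ b, w e.1 b :=
      Finset.single_le_sum (f := fun b => w e.1 b) (fun b _ => hw _ b) (Finset.mem_univ _)
    have h4 : ∑ b, w e.1 b ≤ ∑ a, ∑ b, w a b :=
      Finset.single_le_sum (f := fun a => ∑ b, w a b)
        (fun a _ => Finset.sum_nonneg fun b _ => hw a b) (Finset.mem_univ _)
    linarith
  · push Not at hex
    rw [hα.right_unmatched y hy v hex]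
    exact Finset.sum_nonneg fun a _ => Finset.sum_nonneg fun b _ => hw a b

theorem IsGainSharing.left_le (hα : IsGainSharing g h E w τ α) (hgh : IsParam g h)
    (hw : ∀ a b, 0 ≤ w a b) (hτ : Function.Injective τ)
    (hy : ∀ x, y x ∈ Set.Ico (0 : ℝ) 1) (u : L) : α y (Sum.inl u) ≤ ∑ a, ∑ b, w a b := by
  by_cases hex : ∃ e ∈ matching g E w τ y, e.1 = u
  · obtain ⟨e, he, rfl⟩ := hex
    have h1 := hα.sum_eq y hy e he
    have h2 := hα.right_nonneg hgh hw hτ hy e.2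
    have h3 : w e.1 e.2 ≤ ∑ b, w e.1 b :=
      Finset.single_le_sum (f := fun b => w e.1 b) (fun b _ => hw _ b) (Finset.mem_univ _)
    have h4 : ∑ b, w e.1 b ≤ ∑ a, ∑ b, w a b :=
      Finset.single_le_sum (f := fun a => ∑ b, w a b)
        (fun a _ => Finset.sum_nonneg fun b _ => hw a b) (Finset.mem_univ _)
    linarith
  · push Not at hex
    rw [hα.left_unmatched y hy u hex]
    exact Finset.sum_nonneg fun a _ => Finset.sum_nonneg fun b _ => hw a b

variable {s t : ℝ}

/-- The dual dominates `h t` times the offer in the full run, hence `h t` times the offer without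
`u`; `apply_decInv_le` bounds the latter offer below. The result is uniform in the rank `s` of `u`.
-/
theorem IsGainSharing.right_ge_theta (hα : IsGainSharing g h E w τ α) (hgh : IsParam g h)
    (hw : ∀ a b, 0 ≤ w a b) (hτ : Function.Injective τ) (hwuv : 0 < w u v)
    (hy : ∀ x, y x ∈ Set.Ico (0 : ℝ) 1)
    (hs : s ∈ Set.Ico (0 : ℝ) 1) (ht : t ∈ Set.Ico (0 : ℝ) 1) :
    h t * g (theta g E w τ y u v t) * w u v ≤ α (setRanks y u v s t) (Sum.inr v) := by
  have hy' := setRanks_mem (u := u) (v := v) hy hs ht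
  refine le_trans ?_ (hα.rightOffer_le hτ hy')
  rw [setRanks_inr, mul_assoc]
  refine mul_le_mul_of_nonneg_left ?_ (hgh.h_pos t (Set.Ico_subset_Icc_self ht)).le
  rw [theta_eq hτ (s := s) ht.2]
  refine le_trans ?_ (rightOffer_removeLeft_le (u := u) hgh hw hτ hy')
  rw [← le_div_iff₀ hwuv]
  exact apply_decInv_le hgh.g_one hgh.g_rightCont
    (div_nonneg (rightOffer_nonneg hgh hw hy') hwuv.le)

theorem IsGainSharing.left_ge_beta (hα : IsGainSharing g h E w τ α) (hgh : IsParam g h)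
    (hw : ∀ a b, 0 ≤ w a b) (hτ : Function.Injective τ) (hwuv : 0 < w u v)
    (hy : ∀ x, y x ∈ Set.Ico (0 : ℝ) 1)
    (hs : s ∈ Set.Ico (0 : ℝ) 1) (ht : t ∈ Set.Ico (0 : ℝ) 1) :
    h s * g (beta g E w τ y u v s) * w u v ≤ α (setRanks y u v s t) (Sum.inl u) := by
  have hy' := setRanks_mem (u := u) (v := v) hy hs ht
  refine le_trans ?_ (hα.leftOffer_le hτ hy')
  rw [setRanks_inl, mul_assoc]
  refine mul_le_mul_of_nonneg_left ?_ (hgh.h_pos s (Set.Ico_subset_Icc_self hs)).le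
  rw [beta_eq hτ (t := t) hs.2]
  refine le_trans ?_ (leftOffer_removeRight_le (v := v) hgh hw hτ hy')
  rw [← le_div_iff₀ hwuv]
  exact apply_decInv_le hgh.g_one hgh.g_rightCont
    (div_nonneg (leftOffer_nonneg hgh hw hy') hwuv.le)

/-- Two neighbours whose ranks are both below their marginal ranks are matched together. -/
theorem mem_matching_of_lt (hgh : IsParam g h) (hτ : Function.Injective τ)
    (huv : (u, v) ∈ E) (hwuv : 0 < w u v) (hy : ∀ x, y x ∈ Set.Ico (0 : ℝ) 1)
    (hs : s ∈ Set.Ico (0 : ℝ) 1) (ht : t ∈ Set.Ico (0 : ℝ) 1)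
    (hst : s < theta g E w τ y u v t) (hts : t < beta g E w τ y u v s) :
    (u, v) ∈ matching g E w τ (setRanks y u v s t) := by
  have hy' := setRanks_mem (u := u) (v := v) hy hs ht
  refine (isGreedy_matching hτ E _).mem_of_lt (isGreedy_matching hτ (removeLeft E u) _)
    (isGreedy_matching hτ (removeRight E v) _) (queryKey_injective hτ)
    (fun e => mem_removeLeft) (fun e => mem_removeRight) huv
    (fun e h1 h2 => Prod.ext h1 h2) (fun f hf hfv => ?_) (fun f hf hfu => ?_)
  · replace hfv : f.2 = v := hfv
    -- A rank below the marginal one means that $g(y_u)w_{uv}$ strictly exceeds the offer to `v`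
    -- without `u`. The perturbed weights are then strictly ordered, and tie-breaking plays no role.
    have := lt_of_lt_decInv (Set.Ico_subset_Icc_self hs) ((theta_eq hτ (s := s) ht.2) ▸ hst)
    rw [div_lt_iff₀ hwuv, rightOffer_matching hτ hf hfv] at this
    refine queryKey_lt_iff.2 (Or.inl ?_)
    rw [perturbedWeight_eq_right hfv, perturbedWeight_eq_right (v := v) rfl]
    refine mul_lt_mul_of_pos_left ?_ (hgh.g_pos _ (hy' _))
    simpa [setRanks_inl] using this
  · replace hfu : f.1 = u := hfu
    have := lt_of_lt_decInv (Set.Ico_subset_Icc_self ht) ((beta_eq hτ (t := t) hs.2) ▸ hts)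
    rw [div_lt_iff₀ hwuv, leftOffer_matching hτ hf hfu] at this
    refine queryKey_lt_iff.2 (Or.inl ?_)
    rw [perturbedWeight_eq_left hfu, perturbedWeight_eq_left (u := u) rfl]
    refine mul_lt_mul_of_pos_left ?_ (hgh.g_pos _ (hy' _))
    simpa [setRanks_inr] using this

end Offers

end QuadraticRanking

namespace QuadraticRanking

open MeasureTheory

/-! ### Integration over slices -/

section Slices

theorem integrable_indicator_snd {X Y : Type*} [MeasurableSpace X] [MeasurableSpace Y]
    {μ : Measure X} {ν : Measure Y} [IsProbabilityMeasure μ] [IsProbabilityMeasure ν]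
    {A : Set (X × Y)} (hA : MeasurableSet A) {c : Y → ℝ} (hc : Integrable c ν) :
    Integrable (A.indicator fun p => c p.2) (μ.prod ν) :=
  (hc.comp_snd μ).indicator hA

theorem integrable_slice_mul {X Y : Type*} [MeasurableSpace X] [MeasurableSpace Y]
    {μ : Measure X} {ν : Measure Y} [IsProbabilityMeasure μ] [IsProbabilityMeasure ν]
    {A : Set (X × Y)} (hA : MeasurableSet A) {c : Y → ℝ} (hc : Integrable c ν) :
    Integrable (fun t => μ.real {s | (s, t) ∈ A} * c t) ν := by
  refine hc.bdd_mul (c := 1) (measurable_measure_prodMk_right hA).ennreal_toReal.aestronglyMeasurable ?_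
  refine Filter.Eventually.of_forall fun t => ?_
  rw [Real.norm_of_nonneg measureReal_nonneg]
  exact measureReal_le_one

/-- Fubini's theorem for a function of one coordinate on a subset of the product. -/
theorem integral_indicator_snd {X Y : Type*} [MeasurableSpace X] [MeasurableSpace Y]
    {μ : Measure X} {ν : Measure Y} [IsProbabilityMeasure μ] [IsProbabilityMeasure ν]
    {A : Set (X × Y)} (hA : MeasurableSet A) {c : Y → ℝ} (hc : Integrable c ν) :
    ∫ p, A.indicator (fun p => c p.2) p ∂μ.prod ν = ∫ t, μ.real {s | (s, t) ∈ A} * c t ∂ν := by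
  rw [integral_prod_symm _ (integrable_indicator_snd hA hc)]
  refine integral_congr_ae (Filter.Eventually.of_forall fun t => ?_)
  have hAt : MeasurableSet {s | (s, t) ∈ A} := measurable_prodMk_right hA
  have : (fun s => A.indicator (fun p : X × Y => c p.2) (s, t)) =
      {s | (s, t) ∈ A}.indicator fun _ => c t := by
    rfl
  beta_reduce
  rw [this, integral_indicator_const _ hAt, smul_eq_mul]

/-- A function that is at least `1` on `A` and at least `a p.2 + b p.1` elsewhere, integrated
slice by slice. -/
theorem integral_ge_of_slices {X : Type*} [MeasurableSpace X] {μ : Measure X}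
    [IsProbabilityMeasure μ] {A : Set (X × X)} (hA : MeasurableSet A) {S T a b : X → ℝ}
    (hS : ∀ᵐ t ∂μ, μ.real {s | (s, t) ∈ A} = S t) (hT : ∀ᵐ s ∂μ, μ.real {t | (s, t) ∈ A} = T s)
    (ha : Integrable a μ) (hb : Integrable b μ) {F : X × X → ℝ} (hF : Integrable F (μ.prod μ))
    (hFA : ∀ᵐ p ∂μ.prod μ, p ∈ A → 1 ≤ F p)
    (hFA' : ∀ᵐ p ∂μ.prod μ, p ∉ A → a p.2 + b p.1 ≤ F p) :
    Integrable S μ ∧ Integrable (fun t => (1 - S t) * a t) μ ∧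
      Integrable (fun t => (1 - T t) * b t) μ ∧
      ∫ t, S t ∂μ + ∫ t, (1 - S t) * a t ∂μ + ∫ t, (1 - T t) * b t ∂μ ≤ ∫ p, F p ∂μ.prod μ := by
  -- The term in the first coordinate is moved to the second by swapping, so that one Fubini lemma
  -- serves all three terms.
  have hA' : MeasurableSet (Prod.swap ⁻¹' Aᶜ : Set (X × X)) := measurable_swap hA.compl
  have e1 : (fun t => μ.real {s | (s, t) ∈ A} * (1 : ℝ)) =ᵐ[μ] S := by
    filter_upwards [hS] with t ht
    rw [ht, mul_one]
  have e2 : (fun t => μ.real {s | (s, t) ∈ Aᶜ} * a t) =ᵐ[μ] fun t => (1 - S t) * a t := by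
    filter_upwards [hS] with t ht
    have hAt : MeasurableSet {s | (s, t) ∈ A} := measurable_prodMk_right hA
    rw [← ht, ← probReal_compl_eq_one_sub hAt]
    rfl
  have e3 : (fun s => μ.real {t | (t, s) ∈ (Prod.swap ⁻¹' Aᶜ : Set (X × X))} * b s) =ᵐ[μ]
      fun s => (1 - T s) * b s := by
    filter_upwards [hT] with s hs
    have hAs : MeasurableSet {t | (s, t) ∈ A} := measurable_prodMk_left hA
    rw [← hs, ← probReal_compl_eq_one_sub hAs]
    rfl
  have h1 : Integrable (fun _ : X => (1 : ℝ)) μ := integrable_const 1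
  refine ⟨(integrable_slice_mul hA h1).congr e1, (integrable_slice_mul hA.compl ha).congr e2,
    (integrable_slice_mul hA' hb).congr e3, ?_⟩
  rw [← integral_congr_ae e1, ← integral_congr_ae e2, ← integral_congr_ae e3,
    ← integral_indicator_snd hA h1, ← integral_indicator_snd hA.compl ha,
    ← integral_indicator_snd hA' hb, ← integral_prod_swap
      ((Prod.swap ⁻¹' Aᶜ : Set (X × X)).indicator fun p : X × X => b p.2)]
  have i1 := integrable_indicator_snd (μ := μ) hA h1
  have i2 := integrable_indicator_snd (μ := μ) hA.compl ha
  have i3 := (integrable_indicator_snd (μ := μ) hA' hb).swap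
  simp only [Function.comp_def] at i3
  rw [← integral_add' i1 i2, ← integral_add' (i1.add i2) i3]
  refine integral_mono_ae ((i1.add i2).add i3) hF ?_
  filter_upwards [hFA, hFA'] with p hp hp'
  by_cases hpA : p ∈ A
  · simpa [Set.indicator_apply, hpA] using hp hpA
  · simpa [Set.indicator_apply, hpA] using hp' hpA

theorem bddBelow_incInv (f : ℝ → ℝ) (t : ℝ) :
    BddBelow (insert 1 {x : ℝ | x ∈ Set.Icc (0 : ℝ) 1 ∧ f x > t}) :=
  ⟨0, by rintro x (rfl | hx); exacts [zero_le_one, hx.1.1]⟩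

theorem incInv_nonneg (f : ℝ → ℝ) (t : ℝ) : 0 ≤ incInv f t := by
  refine le_csInf (Set.insert_nonempty _ _) ?_
  rintro x (rfl | hx)
  exacts [zero_le_one, hx.1.1]

theorem lt_of_incInv_lt {f : ℝ → ℝ} (hf : MonotoneOn f (Set.Icc 0 1)) {t x : ℝ}
    (hx : x ∈ Set.Ico (0 : ℝ) 1) (h : incInv f t < x) : t < f x := by
  obtain ⟨z, hz, hzx⟩ := (csInf_lt_iff (bddBelow_incInv f t) (Set.insert_nonempty _ _)).1 h
  rcases hz with rfl | hz
  -- The inserted point `1` is no witness because `x < 1`.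
  · exact absurd hzx (not_lt.2 hx.2.le)
  · exact (show t < f z from hz.2).trans_le (hf hz.1 (Set.Ico_subset_Icc_self hx) hzx.le)

theorem incInv_le {f : ℝ → ℝ} {t x : ℝ} (hx : x ∈ Set.Icc (0 : ℝ) 1) (h : t < f x) :
    incInv f t ≤ x :=
  csInf_le (bddBelow_incInv f t) (Set.mem_insert_of_mem _ ⟨hx, h⟩)

/-- The ranks below `c` at which a non-decreasing `f` exceeds `t`. -/
theorem measureReal_slice {f : ℝ → ℝ} (hf : MonotoneOn f (Set.Icc 0 1)) {c : ℝ}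
    (hc : c ≤ 1) (t : ℝ) :
    (volume : Measure ℝ).real ({x | x < c ∧ t < f x} ∩ Set.Ico (0 : ℝ) 1) =
      max (c - incInv f t) 0 := by
  have h1 : Set.Ioo (incInv f t) c ⊆ {x | x < c ∧ t < f x} ∩ Set.Ico (0 : ℝ) 1 := fun x hx => by
    have hx' : x ∈ Set.Ico (0 : ℝ) 1 := ⟨(incInv_nonneg f t).trans hx.1.le, hx.2.trans_le hc⟩
    exact ⟨⟨hx.2, lt_of_incInv_lt hf hx' hx.1⟩, hx'⟩
  have h2 : {x | x < c ∧ t < f x} ∩ Set.Ico (0 : ℝ) 1 ⊆ Set.Icc (incInv f t) c := fun x hx =>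
    ⟨incInv_le (Set.Ico_subset_Icc_self hx.2) hx.1.2, hx.1.1.le⟩
  -- The set lies between the open and the closed interval with the same endpoints. Truncation in
  -- `ENNReal.ofReal` produces the positive part.
  have h3 : volume ({x | x < c ∧ t < f x} ∩ Set.Ico (0 : ℝ) 1) =
      ENNReal.ofReal (c - incInv f t) :=
    le_antisymm ((measure_mono h2).trans_eq Real.volume_Icc)
      (Real.volume_Ioo.symm.trans_le (measure_mono h1))
  rw [measureReal_def, h3, ENNReal.toReal_ofReal']

end Slices

/-! ### Integrability and the final bound -/

theorem IsParam.integrable_mul {g h : ℝ → ℝ} (hgh : IsParam g h) {θ : ℝ → ℝ}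
    (hθ : MonotoneOn θ (Set.Icc 0 1)) (hθ' : ∀ x, θ x ∈ Set.Icc (0 : ℝ) 1) :
    Integrable (fun t => h t * g (θ t)) (volume.restrict (Set.Ico (0 : ℝ) 1)) := by
  have hsub : Set.Ico (0 : ℝ) 1 ⊆ Set.Icc 0 1 := Set.Ico_subset_Icc_self
  have m1 : AEMeasurable h (volume.restrict (Set.Ico (0 : ℝ) 1)) :=
    aemeasurable_restrict_of_monotoneOn measurableSet_Ico (hgh.h_mono.mono hsub)
  have m2 : AEMeasurable (fun t => g (θ t)) (volume.restrict (Set.Ico (0 : ℝ) 1)) :=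
    aemeasurable_restrict_of_antitoneOn measurableSet_Ico fun s hs t ht hst =>
      hgh.g_anti (hθ' s) (hθ' t) (hθ (hsub hs) (hsub ht) hst)
  refine Integrable.of_bound (m1.mul m2).aestronglyMeasurable (h 1 * g 0) ?_
  refine (ae_restrict_mem measurableSet_Ico).mono fun t ht => ?_
  have h1 := (hgh.h_pos t (hsub ht)).le
  have h2 := hgh.g_nonneg (hθ' t)
  rw [Real.norm_of_nonneg (mul_nonneg h1 h2)]
  exact mul_le_mul (hgh.h_mono (hsub ht) ⟨zero_le_one, le_rfl⟩ ht.2.le)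
    (hgh.g_anti ⟨le_rfl, zero_le_one⟩ (hθ' t) (hθ' t).1) h2
    (hgh.h_pos 1 ⟨zero_le_one, le_rfl⟩).le

theorem IsGainSharing.integrableOn_pairGain {L R : Type*} [Fintype L] [Fintype R]
    [DecidableEq L] [DecidableEq R] {g h : ℝ → ℝ} {E : Finset (L × R)} {w : L → R → ℝ}
    {τ : L × R → ℕ} {α : (L ⊕ R → ℝ) → L ⊕ R → ℝ} (hα : IsGainSharing g h E w τ α)
    (hgh : IsParam g h) (hw : ∀ a b, 0 ≤ w a b) (hτ : Function.Injective τ)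
    {y : L ⊕ R → ℝ} (hy : ∀ x, y x ∈ Set.Ico (0 : ℝ) 1) (u : L) (v : R) :
    IntegrableOn (pairGain α y u v) (Set.Ico (0 : ℝ) 1 ×ˢ Set.Ico (0 : ℝ) 1) := by
  have hm : Measurable fun p : ℝ × ℝ => setRanks y u v p.1 p.2 := by
    refine measurable_pi_iff.2 fun x => ?_
    simp only [setRanks, Function.update_apply]
    split_ifs
    exacts [measurable_snd, measurable_fst, measurable_const]
  have hm' : Measurable (pairGain α y u v) :=
    ((hα.measurable _).comp hm).add ((hα.measurable _).comp hm)
  have hfin : IsFiniteMeasure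
      ((volume : Measure (ℝ × ℝ)).restrict (Set.Ico (0 : ℝ) 1 ×ˢ Set.Ico (0 : ℝ) 1)) := by
    rw [Measure.volume_eq_prod, ← Measure.prod_restrict]
    infer_instance
  refine Integrable.of_bound hm'.aestronglyMeasurable (∑ a, ∑ b, w a b + ∑ a, ∑ b, w a b) ?_
  refine (ae_restrict_mem (measurableSet_Ico.prod measurableSet_Ico)).mono fun p hp => ?_
  have hy' := setRanks_mem (u := u) (v := v) hy hp.1 hp.2
  rw [pairGain, Real.norm_of_nonneg
    (add_nonneg (hα.left_nonneg hgh hw hτ hy' u) (hα.right_nonneg hgh hw hτ hy' v))]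
  exact add_le_add (hα.left_le hgh hw hτ hy' u) (hα.right_le hgh hw hτ hy' v)

end QuadraticRanking

open QuadraticRanking MeasureTheory in
theorem mainTheorem6 {L R : Type*} [Fintype L] [Fintype R] [DecidableEq L] [DecidableEq R]
    (g h : ℝ → ℝ) (hgh : QuadraticRanking.IsParam g h)
    (E : Finset (L × R)) (w : L → R → ℝ) (hw : ∀ a b, 0 ≤ w a b)
    (τ : L × R → ℕ) (hτ : Function.Injective τ)
    (α : (L ⊕ R → ℝ) → L ⊕ R → ℝ) (hα : QuadraticRanking.IsGainSharing g h E w τ α)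
    (u : L) (v : R) (huv : (u, v) ∈ E) (hwuv : 0 < w u v)
    (y : L ⊕ R → ℝ) (hy : ∀ x, y x ∈ Set.Ico (0 : ℝ) 1)
    (θ β : ℝ → ℝ) (hθ : θ = QuadraticRanking.theta g E w τ y u v)
    (hβ : β = QuadraticRanking.beta g E w τ y u v) :
    MonotoneOn θ (Set.Icc 0 1) ∧ MonotoneOn β (Set.Icc 0 1) ∧
    MeasureTheory.IntegrableOn (QuadraticRanking.pairGain α y u v)
      (Set.Ico (0 : ℝ) 1 ×ˢ Set.Ico (0 : ℝ) 1) ∧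
    IntervalIntegrable (fun t => max (θ t - QuadraticRanking.incInv β t) 0)
      MeasureTheory.volume 0 1 ∧
    IntervalIntegrable
      (fun t => (1 - max (θ t - QuadraticRanking.incInv β t) 0) * h t * g (θ t))
      MeasureTheory.volume 0 1 ∧
    IntervalIntegrable
      (fun t => (1 - max (β t - QuadraticRanking.incInv θ t) 0) * h t * g (β t))
      MeasureTheory.volume 0 1 ∧
    (∫ p in Set.Ico (0 : ℝ) 1 ×ˢ Set.Ico (0 : ℝ) 1, QuadraticRanking.pairGain α y u v p) / w u v ≥
      (∫ t in (0 : ℝ)..1, max (θ t - QuadraticRanking.incInv β t) 0)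
      + (∫ t in (0 : ℝ)..1,
          (1 - max (θ t - QuadraticRanking.incInv β t) 0) * h t * g (θ t))
      + (∫ t in (0 : ℝ)..1,
          (1 - max (β t - QuadraticRanking.incInv θ t) 0) * h t * g (β t)) := by
  have hθm : MonotoneOn θ (Set.Icc 0 1) := hθ ▸ theta_monotoneOn hgh hw hτ hy
  have hβm : MonotoneOn β (Set.Icc 0 1) := hβ ▸ beta_monotoneOn hgh hw hτ hy
  have hθI : ∀ x, θ x ∈ Set.Icc (0 : ℝ) 1 := fun x => hθ ▸ theta_mem_Icc x
  have hβI : ∀ x, β x ∈ Set.Icc (0 : ℝ) 1 := fun x => hβ ▸ beta_mem_Icc x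
  have hsub : Set.Ico (0 : ℝ) 1 ⊆ Set.Icc 0 1 := Set.Ico_subset_Icc_self
  have hF := hα.integrableOn_pairGain hgh hw hτ hy u v
  -- Monotone extensions to all of `ℝ` are Borel, which makes the region `A` measurable. Only their
  -- values on $[0,1]$ matter.
  obtain ⟨θ', hθ'm, hθ'⟩ := hθm.exists_monotone_extension
    ⟨0, by rintro _ ⟨x, -, rfl⟩; exact (hθI x).1⟩ ⟨1, by rintro _ ⟨x, -, rfl⟩; exact (hθI x).2⟩
  obtain ⟨β', hβ'm, hβ'⟩ := hβm.exists_monotone_extension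
    ⟨0, by rintro _ ⟨x, -, rfl⟩; exact (hβI x).1⟩ ⟨1, by rintro _ ⟨x, -, rfl⟩; exact (hβI x).2⟩
  set A : Set (ℝ × ℝ) := {p | p.1 < θ' p.2 ∧ p.2 < β' p.1} with hAdef
  have hA : MeasurableSet A :=
    (measurableSet_lt measurable_fst (hθ'm.measurable.comp measurable_snd)).inter
      (measurableSet_lt measurable_snd (hβ'm.measurable.comp measurable_fst))
  set μ : Measure ℝ := volume.restrict (Set.Ico (0 : ℝ) 1) with hμ
  have hprob : IsProbabilityMeasure μ := ⟨by simp [hμ]⟩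
  have hμμ : μ.prod μ = volume.restrict (Set.Ico (0 : ℝ) 1 ×ˢ Set.Ico (0 : ℝ) 1) :=
    Measure.prod_restrict _ _
  have hQ : ∀ᵐ p ∂μ.prod μ, p ∈ Set.Ico (0 : ℝ) 1 ×ˢ Set.Ico (0 : ℝ) 1 := by
    rw [hμμ]
    exact ae_restrict_mem (measurableSet_Ico.prod measurableSet_Ico)
  have hI : ∀ᵐ t ∂μ, t ∈ Set.Ico (0 : ℝ) 1 := ae_restrict_mem measurableSet_Ico
  have hS : ∀ᵐ t ∂μ, μ.real {s | (s, t) ∈ A} = max (θ t - incInv β t) 0 := by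
    filter_upwards [hI] with t ht
    rw [← measureReal_slice hβm (hθI t).2 t, hμ, measureReal_restrict_apply' measurableSet_Ico]
    congr 1
    ext s
    refine and_congr_left fun hs => ?_
    simp only [hAdef, Set.mem_ofPred_eq, hθ' (hsub ht), hβ' (hsub hs)]
  have hT : ∀ᵐ s ∂μ, μ.real {t | (s, t) ∈ A} = max (β s - incInv θ s) 0 := by
    filter_upwards [hI] with s hs
    rw [← measureReal_slice hθm (hβI s).2 s, hμ, measureReal_restrict_apply' measurableSet_Ico]
    congr 1
    ext t
    refine and_congr_left fun ht => ?_
    simp only [hAdef, Set.mem_ofPred_eq, hθ' (hsub ht), hβ' (hsub hs), and_comm]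
  have hF' : Integrable (fun p => pairGain α y u v p / w u v) (μ.prod μ) := by
    rw [hμμ]
    exact hF.div_const _
  obtain ⟨i1, i2, i3, hle⟩ := integral_ge_of_slices hA hS hT (hgh.integrable_mul hθm hθI)
    (hgh.integrable_mul hβm hβI) hF'
    (by
      filter_upwards [hQ] with p hp hpA
      have hy' := setRanks_mem (u := u) (v := v) hy hp.1 hp.2
      simp only [hAdef, Set.mem_ofPred_eq, ← hθ' (hsub hp.2), ← hβ' (hsub hp.1), hθ, hβ] at hpA
      have := hα.sum_eq _ hy' _ (mem_matching_of_lt hgh hτ huv hwuv hy hp.1 hp.2 hpA.1 hpA.2)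
      rw [pairGain, this, div_self hwuv.ne'])
    (by
      filter_upwards [hQ] with p hp _
      have h1 := hα.left_ge_beta hgh hw hτ hwuv hy hp.1 hp.2
      have h2 := hα.right_ge_theta hgh hw hτ hwuv hy hp.1 hp.2
      rw [le_div_iff₀ hwuv, pairGain, hθ, hβ]
      linarith)
  -- What remains is to match the form of the goal: product bracketing, the constant `w u v`, and
  -- half-open intervals that differ by null sets.
  simp only [← mul_assoc] at i2 i3 hle
  rw [hμμ, integral_div] at hle
  refine ⟨hθm, hβm, hF, ?_, ?_, ?_, ?_⟩
  · exact (intervalIntegrable_iff_integrableOn_Ico_of_le zero_le_one).2 i1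
  · exact (intervalIntegrable_iff_integrableOn_Ico_of_le zero_le_one).2 i2
  · exact (intervalIntegrable_iff_integrableOn_Ico_of_le zero_le_one).2 i3
  · simpa only [ge_iff_le, intervalIntegral.integral_of_le zero_le_one,
      ← integral_Ico_eq_integral_Ioc] using hle
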